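/- Work in second order arithmetic. A partial order $(P,\preceq)$ is a set $P\subseteq\mathbb N$ with a reflexive, antisymmetric, transitive relation ${\preceq}\subseteq P\times P$ (coded as a set of numbers by means of the pairing $(i,j)\mapsto (i+j)^2+i$). A set $I\subseteq P$ is an initial interval if $x\preceq y$ and $y\in I$ imply $x\in I$ for all $x,y\in P$; a set $D\subseteq P$ is an antichain if distinct elements of $D$ are incomparable. $P$ has countably many initial intervals if there is a sequence $\{I_n : n\in\mathbb N\}$ of sets (coded by a single set) such that every initial interval $I$ of $P$ equals $I_n$ for some $n$. $P$ has an infinite antichain if some set $D$ is an antichain of $P$ and is infinite (unbounded in $\mathbb N$). Theorem. $\mathsf{RCA}_0$ does not prove the statement "every partial order with countably many initial intervals has no infinite antichains". In fact $\mathbf{REC}$, the $\omega$-model whose sets are the computable subsets of $\mathbb N$, is a model of $\mathsf{RCA}_0$ in which the statement fails. The failure is witnessed by a computable partial order $(P,\preceq)$, with $P\subseteq\mathbb N$, such that 1. every computable initial interval of $P$ is the downward closure $\{y\in P : (\exists x\in F)\; y\preceq x\}$ of a finite set $F\subseteq P$; 2. there is a uniformly computable sequence $\{I_n : n\in\mathbb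 N\}$ whose members are exactly the computable initial intervals of $P$; 3. $P$ has a computable infinite antichain; so that $\mathbf{REC}$ satisfies that $P$ is a partial order that has countably many initial intervals and has an infinite antichain. -/

import Mathlib

namespace SOA

/-! ## The language of second order arithmetic

Two sorts of variables, number variables and set variables, both given by de Bruijn indices:
index `0` refers to the innermost quantifier of the sort in question, and indices that exceed the
number of enclosing quantifiers of that sort are free variables. -/

/-- Number terms: number variables, `0`, `1`, `+`, `·`. -/
inductive Term : Type
  | var (i : ℕ) : Term
  | zero : Term
  | one : Term
  | add (s t : Term) : Term
  | mul (s t : Term) : Term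

/-- Formulas of second order arithmetic. The atomic formulas are `⊥`, `s = t`, `s < t` and
`t ∈ X` (with `X` a set variable). -/
inductive Formula : Type
  | falsum : Formula
  | eq (s t : Term) : Formula
  | lt (s t : Term) : Formula
  | mem (t : Term) (X : ℕ) : Formula
  | imp (φ ψ : Formula) : Formula
  | allN (φ : Formula) : Formula
  | allS (φ : Formula) : Formula

/-- Put `a` in front of the sequence `v`. -/
def cons {α : Type} (a : α) (v : ℕ → α) : ℕ → α
  | 0 => a
  | n + 1 => v n

namespace Term

/-- Simultaneous substitution of terms for the variables. -/
def subst (σ : ℕ → Term) : Term → Term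
  | var i => σ i
  | zero => zero
  | one => one
  | add s t => add (s.subst σ) (t.subst σ)
  | mul s t => mul (s.subst σ) (t.subst σ)

/-- The same term seen from under one more number quantifier. -/
def shift (t : Term) : Term := t.subst (fun i => var (i + 1))

/-- The code `(s + t)² + s` of the ordered pair `(s, t)`, as a term. -/
def pair (s t : Term) : Term := add (mul (add s t) (add s t)) s

end Term

namespace Formula

/-- Simultaneous capture-avoiding substitution: terms `σ i` for the free number variables and set
variables `τ j` for the free set variables. -/
def subst : (ℕ → Term) → (ℕ → ℕ) → Formula → Formula
  | _, _, falsum => falsum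
  | σ, _, eq s t => eq (s.subst σ) (t.subst σ)
  | σ, _, lt s t => lt (s.subst σ) (t.subst σ)
  | σ, τ, mem t X => mem (t.subst σ) (τ X)
  | σ, τ, imp φ ψ => imp (subst σ τ φ) (subst σ τ ψ)
  | σ, τ, allN φ => allN (subst (cons (Term.var 0) (fun i => (σ i).shift)) τ φ)
  | σ, τ, allS φ => allS (subst σ (cons 0 (fun j => τ j + 1)) φ)

/-- The same formula seen from under one more number quantifier. -/
def shiftN (φ : Formula) : Formula := φ.subst (fun i => Term.var (i + 1)) id

/-- The same formula seen from under one more set quantifier. -/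
def shiftS (φ : Formula) : Formula := φ.subst Term.var (fun j => j + 1)

/-- Instantiate number variable `0` by `t` (and lower the other number variables by one). -/
def instN (φ : Formula) (t : Term) : Formula := φ.subst (cons t Term.var) id

/-- Instantiate set variable `0` by the set variable `X` (and lower the others by one). -/
def instS (φ : Formula) (X : ℕ) : Formula := φ.subst Term.var (cons X id)

/-- `φ(n + 1)` for `φ = φ(n)`, where `n` is number variable `0`. -/
def succN (φ : Formula) : Formula :=
  φ.subst (cons (Term.add (Term.var 0) Term.one) (fun i => Term.var (i + 1))) id

/-! Defined connectives and quantifiers (classical logic). -/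

def neg (φ : Formula) : Formula := imp φ falsum
def and (φ ψ : Formula) : Formula := neg (imp φ (neg ψ))
def or (φ ψ : Formula) : Formula := imp (neg φ) ψ
def iff (φ ψ : Formula) : Formula := and (imp φ ψ) (imp ψ φ)
def exN (φ : Formula) : Formula := neg (allN (neg φ))
def exS (φ : Formula) : Formula := neg (allS (neg φ))

end Formula

infixr:62 " ⇒ₐ " => Formula.imp
infixr:64 " ⩓ₐ " => Formula.and
infixr:63 " ⩔ₐ " => Formula.or
infix:61 " ⇔ₐ " => Formula.iff
prefix:max "♯" => Term.var

open Formula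

/-! ## Derivability -/

/-- Derivability `T ⊢ φ` in classical two-sorted first order logic with equality between numbers,
as a Hilbert calculus with modus ponens and generalization. Members of `T` with free variables
are, as usual, understood as universally closed. -/
inductive Provable (T : Set Formula) : Formula → Prop
  | ax {φ : Formula} : φ ∈ T → Provable T φ
  | mp {φ ψ : Formula} : Provable T (φ ⇒ₐ ψ) → Provable T φ → Provable T ψ
  | genN {φ : Formula} : Provable T φ → Provable T (allN φ)
  | genS {φ : Formula} : Provable T φ → Provable T (allS φ)
  | weak (φ ψ : Formula) : Provable T (φ ⇒ₐ ψ ⇒ₐ φ)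
  | dist (φ ψ χ : Formula) : Provable T ((φ ⇒ₐ ψ ⇒ₐ χ) ⇒ₐ (φ ⇒ₐ ψ) ⇒ₐ φ ⇒ₐ χ)
  | dne (φ : Formula) : Provable T (neg (neg φ) ⇒ₐ φ)
  | allN_elim (φ : Formula) (t : Term) : Provable T (allN φ ⇒ₐ φ.instN t)
  | allS_elim (φ : Formula) (X : ℕ) : Provable T (allS φ ⇒ₐ φ.instS X)
  | allN_dist (φ ψ : Formula) : Provable T (allN (φ ⇒ₐ ψ) ⇒ₐ allN φ ⇒ₐ allN ψ)
  | allS_dist (φ ψ : Formula) : Provable T (allS (φ ⇒ₐ ψ) ⇒ₐ allS φ ⇒ₐ allS ψ)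
  | allN_vac (φ : Formula) : Provable T (φ ⇒ₐ allN φ.shiftN)
  | allS_vac (φ : Formula) : Provable T (φ ⇒ₐ allS φ.shiftS)
  | eq_refl (t : Term) : Provable T (eq t t)
  | eq_subst (φ : Formula) (s t : Term) : Provable T (eq s t ⇒ₐ φ.instN s ⇒ₐ φ.instN t)

/-! ## The system `RCA₀` -/

/-- Bounded quantifier formulas: no set quantifiers, and every number quantifier is of the form
`∀ n < t` with `n` not occurring in `t` (`∃ n < t` is `¬ ∀ n < t ¬`). Free set variables are
allowed. -/
inductive IsBounded : Formula → Prop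
  | falsum : IsBounded falsum
  | eq (s t : Term) : IsBounded (eq s t)
  | lt (s t : Term) : IsBounded (lt s t)
  | mem (t : Term) (X : ℕ) : IsBounded (mem t X)
  | imp {φ ψ : Formula} : IsBounded φ → IsBounded ψ → IsBounded (φ ⇒ₐ ψ)
  | ball {φ : Formula} (t : Term) : IsBounded φ → IsBounded (allN (lt ♯0 t.shift ⇒ₐ φ))

/-- `Σ⁰₁` formulas: `∃ n θ` with `θ` a bounded quantifier formula. -/
def IsSigma1 (φ : Formula) : Prop := ∃ θ, IsBounded θ ∧ φ = exN θ

/-- `Π⁰₁` formulas: `∀ n θ` with `θ` a bounded quantifier formula. -/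
def IsPi1 (φ : Formula) : Prop := ∃ θ, IsBounded θ ∧ φ = allN θ

/-- The basic axioms of arithmetic (with `m` = variable `1`, `n` = variable `0`). -/
def basicAxioms : Set Formula :=
  { neg (eq ((♯0).add Term.one) Term.zero),
    eq ((♯1).add Term.one) ((♯0).add Term.one) ⇒ₐ eq ♯1 ♯0,
    eq ((♯1).add Term.zero) ♯1,
    eq ((♯1).add ((♯0).add Term.one)) (((♯1).add ♯0).add Term.one),
    eq ((♯1).mul Term.zero) Term.zero,
    eq ((♯1).mul ((♯0).add Term.one)) (((♯1).mul ♯0).add ♯1),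
    neg (lt ♯1 Term.zero),
    lt ♯1 ((♯0).add Term.one) ⇔ₐ (lt ♯1 ♯0 ⩔ₐ eq ♯1 ♯0) }

/-- `φ(0) ∧ ∀ n (φ(n) → φ(n + 1)) → ∀ n φ(n)`, with `n` number variable `0` of `φ`. -/
def inductionAxiom (φ : Formula) : Formula :=
  (φ.instN Term.zero ⩓ₐ allN (φ ⇒ₐ φ.succN)) ⇒ₐ allN φ

/-- `∀ n (φ(n) ↔ ψ(n)) → ∃ X ∀ n (n ∈ X ↔ φ(n))`, with `n` number variable `0` of `φ` and `ψ`, and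
`X` not free in `φ`. -/
def comprehensionAxiom (φ ψ : Formula) : Formula :=
  allN (φ ⇔ₐ ψ) ⇒ₐ exS (allN (mem ♯0 0 ⇔ₐ φ.shiftS))

/-- `RCA₀`: basic axioms, `Σ⁰₁` induction and `Δ⁰₁` comprehension (number and set parameters are
allowed in both schemes). -/
def RCA0 : Set Formula :=
  basicAxioms ∪ {χ | ∃ φ, IsSigma1 φ ∧ χ = inductionAxiom φ} ∪
    {χ | ∃ φ ψ, IsSigma1 φ ∧ IsPi1 ψ ∧ χ = comprehensionAxiom φ ψ}

/-! ## The statement on partial orders, as a sentence of second order arithmetic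

Below `P R I D` are (indices of) set variables. A binary relation is coded by the set `R` of the
codes of its pairs. -/

/-- `s ⪯ t`, i.e. `(s, t) ∈ R`. -/
def leF (R : ℕ) (s t : Term) : Formula := mem (s.pair t) R

/-- `D ⊆ P`. -/
def subsetF (D P : ℕ) : Formula := allN (mem ♯0 D ⇒ₐ mem ♯0 P)

/-- `R ⊆ P × P` and `R` is reflexive on `P`, antisymmetric and transitive. -/
def partialOrderF (P R : ℕ) : Formula :=
  allN (mem ♯0 R ⇒ₐ exN (exN (mem ♯1 P ⩓ₐ mem ♯0 P ⩓ₐ eq ♯2 ((♯1).pair ♯0)))) ⩓ₐ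
  allN (mem ♯0 P ⇒ₐ leF R ♯0 ♯0) ⩓ₐ
  allN (allN (leF R ♯1 ♯0 ⇒ₐ leF R ♯0 ♯1 ⇒ₐ eq ♯1 ♯0)) ⩓ₐ
  allN (allN (allN (leF R ♯2 ♯1 ⇒ₐ leF R ♯1 ♯0 ⇒ₐ leF R ♯2 ♯0)))

/-- `I` is an initial interval of `(P, R)`. -/
def initialIntervalF (P R I : ℕ) : Formula :=
  subsetF I P ⩓ₐ
  allN (allN (mem ♯1 P ⇒ₐ mem ♯0 P ⇒ₐ (leF R ♯1 ♯0 ⩓ₐ mem ♯0 I) ⇒ₐ mem ♯1 I))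

/-- `(P, R)` has countably many initial intervals: there is a set `S`, coding the sequence of the
sets `Sₙ = {x | (x, n) ∈ S}`, such that every initial interval `I` equals some `Sₙ`.
(Under the two set quantifiers `S` has index `1` and `I` has index `0`.) -/
def countablyManyInitialIntervalsF (P R : ℕ) : Formula :=
  exS (allS (initialIntervalF (P + 2) (R + 2) 0 ⇒ₐ
    exN (allN (mem ♯0 0 ⇔ₐ mem ((♯0).pair ♯1) 1))))

/-- `D` is an antichain of `(P, R)`. -/
def antichainF (P R D : ℕ) : Formula :=
  subsetF D P ⩓ₐ
  allN (allN (mem ♯1 D ⇒ₐ mem ♯0 D ⇒ₐ neg (eq ♯1 ♯0) ⇒ₐ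
    (neg (leF R ♯1 ♯0) ⩓ₐ neg (leF R ♯0 ♯1))))

/-- `D` is infinite, i.e. unbounded. -/
def infiniteF (D : ℕ) : Formula := allN (exN (lt ♯1 ♯0 ⩓ₐ mem ♯0 D))

/-- `(P, R)` has an infinite antichain. -/
def infiniteAntichainF (P R : ℕ) : Formula :=
  exS (antichainF (P + 1) (R + 1) 0 ⩓ₐ infiniteF 0)

/-- The sentence: every partial order with countably many initial intervals has no infinite
antichains. -/
def countablyManyIntervalsNoInfiniteAntichain : Formula :=
  allS (allS ((partialOrderF 1 0 ⩓ₐ countablyManyInitialIntervalsF 1 0) ⇒ₐ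
    neg (infiniteAntichainF 1 0)))

/-! ## Structures and satisfaction -/

/-- Structures for the language of second order arithmetic (with general, i.e. Henkin, semantics:
the set variables range over a designated family of subsets of the number domain). -/
structure Structure where
  Num : Type
  sets : Set (Set Num)
  zero : Num
  one : Num
  add : Num → Num → Num
  mul : Num → Num → Num
  lt : Num → Num → Prop

namespace Structure

def termVal (M : Structure) (v : ℕ → M.Num) : Term → M.Num
  | Term.var i => v i
  | Term.zero => M.zero
  | Term.one => M.one
  | Term.add s t => M.add (M.termVal v s) (M.termVal v t)
  | Term.mul s t => M.mul (M.termVal v s) (M.termVal v t)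

/-- Satisfaction of a formula under an assignment `v` of numbers and `V` of sets. -/
def Sat (M : Structure) : (ℕ → M.Num) → (ℕ → M.sets) → Formula → Prop
  | _, _, Formula.falsum => False
  | v, _, Formula.eq s t => M.termVal v s = M.termVal v t
  | v, _, Formula.lt s t => M.lt (M.termVal v s) (M.termVal v t)
  | v, V, Formula.mem t X => M.termVal v t ∈ (V X : Set M.Num)
  | v, V, Formula.imp φ ψ => M.Sat v V φ → M.Sat v V ψ
  | v, V, Formula.allN φ => ∀ a : M.Num, M.Sat (cons a v) V φ
  | v, V, Formula.allS φ => ∀ A : M.sets, M.Sat v (cons A V) φ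

/-- `M ⊨ φ`: `φ` (universally closed) holds in `M`. -/
def Models (M : Structure) (φ : Formula) : Prop := ∀ v V, M.Sat v V φ

end Structure

/-- The `ω`-model whose numbers are the standard natural numbers and whose sets are those in `𝒮`. -/
def omegaModel (𝒮 : Set (Set ℕ)) : Structure where
  Num := ℕ
  sets := 𝒮
  zero := 0
  one := 1
  add := (· + ·)
  mul := (· * ·)
  lt := (· < ·)

/-- The computable sets of natural numbers. -/
def computableSets : Set (Set ℕ) := {X | ComputablePred fun n => n ∈ X}

/-- `REC`, the `ω`-model of computable sets. -/
def REC : Structure := omegaModel computableSets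

/-! ## Partial orders on sets of natural numbers -/

/-- `(P, le)` is a partial order: `le ⊆ P × P` is reflexive on `P`, antisymmetric, transitive. -/
structure IsPartialOrderOn (P : Set ℕ) (le : ℕ → ℕ → Prop) : Prop where
  field : ∀ x y, le x y → x ∈ P ∧ y ∈ P
  refl : ∀ x ∈ P, le x x
  antisymm : ∀ x y, le x y → le y x → x = y
  trans : ∀ x y z, le x y → le y z → le x z

/-- `I` is an initial interval of `(P, le)`. -/
def IsInitialInterval (P : Set ℕ) (le : ℕ → ℕ → Prop) (I : Set ℕ) : Prop :=
  I ⊆ P ∧ ∀ x ∈ P, ∀ y ∈ P, le x y → y ∈ I → x ∈ I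

/-- The downward closure of `F` in `(P, le)`. -/
def downClosure (P : Set ℕ) (le : ℕ → ℕ → Prop) (F : Set ℕ) : Set ℕ :=
  {y ∈ P | ∃ x ∈ F, le y x}

/-- The set of codes `(x + y)² + x` of the pairs in a relation. -/
def codeRel (le : ℕ → ℕ → Prop) : Set ℕ :=
  {z | ∃ x y, le x y ∧ z = (x + y) * (x + y) + x}

end SOA

namespace SOA

/-! ### Semantics: substitution and soundness -/

namespace Structure

variable (M : Structure)

/-! By soundness (`Provable.sound`), unprovability follows once `REC` satisfies `RCA0` and refutes
the statement. Induction holds in `REC` because its numbers are standard. Comprehension holds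
because bounded formulas with computable set parameters are decidable, so a set with both a Σ⁰₁ and
a Π⁰₁ definition is decided by search.

The order is built by a finite injury construction. Each program `e` gets an even witness `x`. Once
the program is seen to output `0` on `x` ("`x` is not in my set"), later numbers are put above `x`
as long as `x` remains a witness; once it is seen to output anything else, they are put below `x`.
When a witness halts, the later entries of the stack are discarded, so every position is injured
only finitely often and ends with a permanent witness (`exists_permanent_prefix`). Let `e` decide an
initial interval `J`, with permanent witness `x`. If `x ∉ J`, almost all numbers lie above `x`, so
`J` is finite. If `x ∈ J`, almost all numbers lie below `x`, so `x` and finitely many further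
elements generate `J`. Finitely generated intervals can be listed computably, since comparing two
numbers only needs the stack at the stage given by the larger one. Odd numbers are never witnesses,
hence pairwise incomparable. Transitivity rests on `mem_witnesses`: discarding ensures that a
surviving witness still sees beneath it the stack, with the same outputs, that was there when it was
appointed. -/

theorem termVal_subst (v : ℕ → M.Num) (σ : ℕ → Term) (t : Term) :
    M.termVal v (t.subst σ) = M.termVal (fun i => M.termVal v (σ i)) t := by
  induction t with
  | var i => rfl
  | zero => rfl
  | one => rfl
  | add s t hs ht => simp only [Term.subst, termVal, hs, ht]
  | mul s t hs ht => simp only [Term.subst, termVal, hs, ht]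

theorem termVal_shift (a : M.Num) (v : ℕ → M.Num) (t : Term) :
    M.termVal (cons a v) t.shift = M.termVal v t := by
  rw [Term.shift, termVal_subst]
  rfl

theorem sat_subst (φ : Formula) : ∀ (v : ℕ → M.Num) (V : ℕ → M.sets) (σ : ℕ → Term) (τ : ℕ → ℕ),
    M.Sat v V (φ.subst σ τ) ↔ M.Sat (fun i => M.termVal v (σ i)) (fun j => V (τ j)) φ := by
  induction φ with
  | falsum => intros; rfl
  | eq s t => intros; simp only [Formula.subst, Sat, termVal_subst]
  | lt s t => intros; simp only [Formula.subst, Sat, termVal_subst]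
  | mem t X => intros; simp only [Formula.subst, Sat, termVal_subst]
  | imp φ ψ hφ hψ => intros; simp only [Formula.subst, Sat, hφ, hψ]
  | allN φ h =>
    intro v V σ τ
    simp only [Formula.subst, Sat, h]
    refine forall_congr' fun a => ?_
    have : (fun i => M.termVal (cons a v) (cons ♯0 (fun i => (σ i).shift) i)) =
        cons a (fun i => M.termVal v (σ i)) := by
      funext i
      cases i with
      | zero => rfl
      | succ i => exact M.termVal_shift a v (σ i)
    rw [this]
  | allS φ h =>
    intro v V σ τ
    simp only [Formula.subst, Sat, h]
    refine forall_congr' fun A => ?_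
    have : (fun j => cons A V (cons 0 (fun j => τ j + 1) j)) = cons A (fun j => V (τ j)) := by
      funext j
      cases j <;> rfl
    rw [this]

theorem sat_shiftN (a : M.Num) (v : ℕ → M.Num) (V : ℕ → M.sets) (φ : Formula) :
    M.Sat (cons a v) V φ.shiftN ↔ M.Sat v V φ :=
  M.sat_subst φ _ _ _ _

theorem sat_shiftS (A : M.sets) (v : ℕ → M.Num) (V : ℕ → M.sets) (φ : Formula) :
    M.Sat v (cons A V) φ.shiftS ↔ M.Sat v V φ :=
  M.sat_subst φ _ _ _ _

theorem sat_instN (v : ℕ → M.Num) (V : ℕ → M.sets) (φ : Formula) (t : Term) :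
    M.Sat v V (φ.instN t) ↔ M.Sat (cons (M.termVal v t) v) V φ := by
  rw [Formula.instN, sat_subst]
  have : (fun i => M.termVal v (cons t Term.var i)) = cons (M.termVal v t) v := by
    funext i
    cases i <;> rfl
  rw [this]
  rfl

theorem sat_instS (v : ℕ → M.Num) (V : ℕ → M.sets) (φ : Formula) (X : ℕ) :
    M.Sat v V (φ.instS X) ↔ M.Sat v (cons (V X) V) φ := by
  rw [Formula.instS, sat_subst]
  have : (fun j => V (cons X id j)) = cons (V X) V := by
    funext j
    cases j <;> rfl
  rw [this]
  rfl

theorem sat_succN (a : M.Num) (v : ℕ → M.Num) (V : ℕ → M.sets) (φ : Formula) :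
    M.Sat (cons a v) V φ.succN ↔ M.Sat (cons (M.add a M.one) v) V φ := by
  rw [Formula.succN, sat_subst]
  have : (fun i => M.termVal (cons a v)
      (cons ((♯0).add Term.one) (fun i => Term.var (i + 1)) i)) = cons (M.add a M.one) v := by
    funext i
    cases i <;> rfl
  rw [this]
  rfl

variable {M} (v : ℕ → M.Num) (V : ℕ → M.sets)

theorem sat_imp (φ ψ : Formula) : M.Sat v V (φ ⇒ₐ ψ) ↔ (M.Sat v V φ → M.Sat v V ψ) := Iff.rfl

theorem sat_allN (φ : Formula) : M.Sat v V φ.allN ↔ ∀ a, M.Sat (cons a v) V φ := Iff.rfl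

theorem sat_allS (φ : Formula) : M.Sat v V φ.allS ↔ ∀ A, M.Sat v (cons A V) φ := Iff.rfl

theorem sat_neg (φ : Formula) : M.Sat v V φ.neg ↔ ¬ M.Sat v V φ := Iff.rfl

theorem sat_and (φ ψ : Formula) : M.Sat v V (φ ⩓ₐ ψ) ↔ M.Sat v V φ ∧ M.Sat v V ψ := by
  simp only [Formula.and, sat_neg, sat_imp]
  tauto

theorem sat_or (φ ψ : Formula) : M.Sat v V (φ ⩔ₐ ψ) ↔ M.Sat v V φ ∨ M.Sat v V ψ := by
  simp only [Formula.or, sat_neg, sat_imp]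
  tauto

theorem sat_iff (φ ψ : Formula) : M.Sat v V (φ ⇔ₐ ψ) ↔ (M.Sat v V φ ↔ M.Sat v V ψ) := by
  simp only [Formula.iff, sat_and, sat_imp]
  tauto

theorem sat_exN (φ : Formula) : M.Sat v V φ.exN ↔ ∃ a, M.Sat (cons a v) V φ := by
  simp only [Formula.exN, sat_neg, sat_allN, not_forall, not_not]

theorem sat_exS (φ : Formula) : M.Sat v V φ.exS ↔ ∃ A, M.Sat v (cons A V) φ := by
  simp only [Formula.exS, sat_neg, sat_allS, not_forall, not_not]

end Structure

open Structure

/-- Every model of `T` satisfies all theorems of `T`. -/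
theorem Provable.sound {T : Set Formula} {M : Structure} (hM : ∀ φ ∈ T, M.Models φ) {φ : Formula}
    (h : Provable T φ) : M.Models φ := by
  induction h with
  | ax h => exact hM _ h
  | mp _ _ h₁ h₂ => exact fun v V => h₁ v V (h₂ v V)
  | genN _ h => exact fun v V a => h _ _
  | genS _ h => exact fun v V A => h _ _
  | weak φ ψ => exact fun v V h _ => h
  | dist φ ψ χ => exact fun v V h₁ h₂ h => h₁ h (h₂ h)
  | dne φ => exact fun v V h => not_not.1 h
  | allN_elim φ t => exact fun v V h => (M.sat_instN v V φ t).2 (h _)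
  | allS_elim φ X => exact fun v V h => (M.sat_instS v V φ X).2 (h _)
  | allN_dist φ ψ => exact fun v V h₁ h₂ a => h₁ a (h₂ a)
  | allS_dist φ ψ => exact fun v V h₁ h₂ a => h₁ a (h₂ a)
  | allN_vac φ => exact fun v V h a => (M.sat_shiftN a v V φ).2 h
  | allS_vac φ => exact fun v V h A => (M.sat_shiftS A v V φ).2 h
  | eq_refl t => exact fun v V => rfl
  | eq_subst φ s t =>
    intro v V (h : M.termVal v s = M.termVal v t) hs
    rw [sat_instN] at hs ⊢
    rwa [← h]

/-! ### Computable predicates -/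

section Computability

variable {α : Type} [Primcodable α]

theorem computablePred_comp {β : Type} [Primcodable β] {p : β → Prop} {f : α → β}
    (hp : ComputablePred p) (hf : Computable f) : ComputablePred fun a => p (f a) := by
  obtain ⟨_, hp⟩ := hp
  exact ⟨fun a => inferInstance, hp.comp hf⟩

theorem computablePred_imp {p q : α → Prop} (hp : ComputablePred p) (hq : ComputablePred q) :
    ComputablePred fun a => p a → q a := by
  classical
  refine Computable.computablePred ?_
  refine (Computable.cond hp.decide hq.decide (Computable.const true)).of_eq fun a => ?_
  by_cases h : p a <;> simp [h]

theorem computablePred_ball {p : α × ℕ → Prop} {f : α → ℕ} (hp : ComputablePred p)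
    (hf : Computable f) : ComputablePred fun a => ∀ n < f a, p (a, n) := by
  classical
  refine Computable.computablePred ?_
  have h : Computable fun a => (f a).rec (motive := fun _ => Bool) true
      fun n IH => cond IH (decide (p (a, n))) false :=
    Computable.nat_rec hf (Computable.const true) (Computable.cond
      (Computable.snd.comp Computable.snd)
      (hp.decide.comp (Computable.pair Computable.fst (Computable.fst.comp Computable.snd)))
      (Computable.const false)).to₂
  refine h.of_eq fun a => ?_
  induction f a with
  | zero => simp
  | succ k ih =>
    simp only [← ih, Nat.forall_lt_succ_right, Bool.decide_and, Bool.cond_false_right]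

/-- A predicate with both an existential and a universal computable definition is computable. -/
theorem computablePred_of_exists_iff_forall {p q : α × ℕ → Prop} (hp : ComputablePred p)
    (hq : ComputablePred q) (h : ∀ a, (∃ n, p (a, n)) ↔ ∀ n, q (a, n)) :
    ComputablePred fun a => ∃ n, p (a, n) := by
  classical
  -- Search for an `n` that either verifies the existential form or refutes the universal one. The
  -- search always ends, and testing `p` at the `n` found decides the predicate.
  have hex : ∀ a, ∃ n, (q (a, n) → p (a, n)) := by
    intro a
    by_cases ha : ∃ n, p (a, n)
    · exact ha.imp fun n hn _ => hn
    · obtain ⟨n, hn⟩ := not_forall.1 (mt (h a).2 ha)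
      exact ⟨n, fun h => absurd h hn⟩
  have hc := Computable.find (P := fun a n => q (a, n) → p (a, n)) (computablePred_imp hq hp) hex
  refine (computablePred_comp hp (Computable.pair Computable.id hc)).of_eq fun a =>
    ⟨fun ha => ⟨_, ha⟩, fun ha => Nat.find_spec (hex a) ((h a).1 ha _)⟩

end Computability

/-! ### `REC` is a model of `RCA₀` -/

theorem computable_cons {α : Type} [Primcodable α] {v : α → ℕ → ℕ}
    (hv : ∀ i, Computable fun a => v a i) (i : ℕ) :
    Computable fun p : α × ℕ => cons p.2 (v p.1) i := by
  cases i with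
  | zero => exact Computable.snd
  | succ i => exact (hv i).comp Computable.fst

theorem computable_termVal {α : Type} [Primcodable α] {v : α → ℕ → ℕ}
    (hv : ∀ i, Computable fun a => v a i) (t : Term) :
    Computable (σ := ℕ) fun a => REC.termVal (v a) t := by
  induction t with
  | var i => exact hv i
  | zero => exact Computable.const 0
  | one => exact Computable.const 1
  | add s t hs ht => exact Primrec.nat_add.to_comp.comp hs ht
  | mul s t hs ht => exact Primrec.nat_mul.to_comp.comp hs ht

/-- The number assignment depends computably on a parameter from an arbitrary type, so that under a
bounded quantifier the bound variable can be absorbed into the parameter. -/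
theorem computablePred_sat {θ : Formula} (hθ : IsBounded θ) :
    ∀ {α : Type} [Primcodable α] {v : α → ℕ → ℕ} (_ : ∀ i, Computable fun a => v a i)
      (V : ℕ → REC.sets), ComputablePred fun a => REC.Sat (v a) V θ := by
  induction hθ with
  | falsum =>
    intro α _ v hv V
    exact ⟨fun _ => .isFalse id, Computable.const false⟩
  | eq s t =>
    intro α _ v hv V
    exact computablePred_comp (p := fun p : ℕ × ℕ => p.1 = p.2) (Primrec.eq (α := ℕ)).computablePred
      ((computable_termVal hv s).pair (computable_termVal hv t))
  | lt s t =>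
    intro α _ v hv V
    exact computablePred_comp (p := fun p : ℕ × ℕ => p.1 < p.2) Primrec.nat_lt.computablePred
      ((computable_termVal hv s).pair (computable_termVal hv t))
  | mem t X =>
    intro α _ v hv V
    exact computablePred_comp (β := ℕ) (V X).2 (computable_termVal hv t)
  | imp _ _ h₁ h₂ =>
    intro α _ v hv V
    exact computablePred_imp (h₁ hv V) (h₂ hv V)
  | ball t _ h =>
    intro α _ v hv V
    refine (computablePred_ball (h (computable_cons hv) V) (computable_termVal hv t)).of_eq
      fun a => forall_congr' fun n => ?_
    rw [sat_imp]
    refine imp_congr_left ?_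
    have e : REC.termVal (cons n (v a)) t.shift = REC.termVal (v a) t :=
      REC.termVal_shift n (v a) t
    change _ ↔ n < REC.termVal (cons n (v a)) t.shift
    exact Eq.to_iff (congrArg (fun k : ℕ => n < k) e.symm)

theorem REC_models_basicAxioms {χ : Formula} (h : χ ∈ basicAxioms) : REC.Models χ := by
  intro v V
  simp only [basicAxioms, Set.mem_insert_iff, Set.mem_singleton_iff] at h
  rcases h with rfl | rfl | rfl | rfl | rfl | rfl | rfl | rfl
  · exact Nat.succ_ne_zero (v 0)
  · exact fun h => Nat.succ_injective h
  · exact Nat.add_zero (v 1)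
  · exact (Nat.add_assoc (v 1) (v 0) 1).symm
  · exact Nat.mul_zero (v 1)
  · exact Nat.mul_succ (v 1) (v 0)
  · exact Nat.not_lt_zero (v 1)
  · rw [sat_iff, sat_or]
    exact Nat.lt_succ_iff_lt_or_eq (m := v 1) (n := v 0)

theorem REC_models_inductionAxiom (φ : Formula) : REC.Models (inductionAxiom φ) := by
  intro v V
  rw [inductionAxiom, sat_imp, sat_and, sat_instN]
  rintro ⟨h₀, hs⟩ n
  change ℕ at n
  induction n with
  | zero => exact h₀
  | succ n ih => exact (REC.sat_succN n v V φ).1 (hs n ih)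

theorem REC_models_comprehensionAxiom {φ ψ : Formula} (hφ : IsSigma1 φ) (hψ : IsPi1 ψ) :
    REC.Models (comprehensionAxiom φ ψ) := by
  obtain ⟨θ, hθ, rfl⟩ := hφ
  obtain ⟨η, hη, rfl⟩ := hψ
  intro v V
  rw [comprehensionAxiom, sat_imp, sat_allN, sat_exS]
  intro h
  simp only [sat_iff, sat_exN, sat_allN] at h
  have hv : ∀ i, Computable fun p : ℕ × ℕ => cons p.2 (cons p.1 v) i :=
    computable_cons (v := fun n => cons n v) fun i => by
      cases i with
      | zero => exact Computable.id
      | succ i => exact Computable.const (σ := ℕ) (v i)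
  have hc : ComputablePred fun n : ℕ => ∃ m, REC.Sat (cons m (cons n v)) V θ :=
    computablePred_of_exists_iff_forall
      (p := fun p : ℕ × ℕ => REC.Sat (cons p.2 (cons p.1 v)) V θ)
      (q := fun p : ℕ × ℕ => REC.Sat (cons p.2 (cons p.1 v)) V η)
      (computablePred_sat hθ hv V) (computablePred_sat hη hv V) h
  refine ⟨⟨{n : ℕ | ∃ m, REC.Sat (cons m (cons n v)) V θ}, hc⟩, fun n => ?_⟩
  rw [sat_iff, sat_shiftS, sat_exN]
  exact Iff.rfl

theorem REC_models_RCA0 : ∀ φ ∈ RCA0, REC.Models φ := by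
  rintro χ ((h | ⟨φ, -, rfl⟩) | ⟨φ, ψ, hφ, hψ, rfl⟩)
  · exact REC_models_basicAxioms h
  · exact REC_models_inductionAxiom φ
  · exact REC_models_comprehensionAxiom hφ hψ

end SOA

namespace SOA

open Nat.Partrec (Code)
open Nat.Partrec.Code

/-! ### The computable partial order

Even numbers serve as witnesses: the `e`-th entry of the stack at stage `s` is the current witness
for the `e`-th program. When the computation on a witness is seen to halt, the witness becomes
active and all witnesses above it are discarded. New numbers are put above an active witness that
was rejected by its program, and below an active witness that was accepted. -/

/-- The output of the `e`-th program on input `x`, if it is seen by stage `s`. -/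
def outputBy (s e x : ℕ) : Option ℕ := evaln s (Denumerable.ofNat Code e) x

/-- The computation on the witness `p.2` for the program `p.1` is first seen to halt at stage
`s + 1`. -/
def haltsAt (s : ℕ) (p : ℕ × ℕ) : Bool :=
  (outputBy (s + 1) p.1 p.2).isSome && (outputBy s p.1 p.2).isNone

/-- The shortest prefix of a list that ends in an element satisfying `f`, or the whole list. -/
def cutAfter {α : Type} (f : α → Bool) (l : List α) : List α :=
  l.foldr (fun a r => cond (f a) [a] (a :: r)) []

/-- Add `s` as a new witness if it is even. -/
def pushWitness (s : ℕ) (l : List (ℕ × ℕ)) : List (ℕ × ℕ) :=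
  cond s.bodd l (l ++ [(l.length, s)])

/-- The witnesses (paired with the indices of their programs) in force at stage `s`. -/
def witnesses (s : ℕ) : List (ℕ × ℕ) :=
  s.rec [] fun s l => cutAfter (haltsAt s) (pushWitness s l)

/-- `x` is a rejected witness at stage `z`. -/
def Rejected (x z : ℕ) : Prop :=
  ∃ p ∈ witnesses z, p.2 = x ∧ outputBy z p.1 p.2 = some 0

/-- `x` is an accepted witness at stage `z`. -/
def Accepted (x z : ℕ) : Prop :=
  ∃ p ∈ witnesses z, p.2 = x ∧ (outputBy z p.1 p.2).isSome ∧ outputBy z p.1 p.2 ≠ some 0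

/-- The partial order on `ℕ`. -/
def witnessLE (x z : ℕ) : Prop := x = z ∨ Rejected x z ∨ Accepted z x

/-! #### Computability -/

theorem primrec_outputBy : Primrec fun p : (ℕ × ℕ) × ℕ => outputBy p.1.1 p.1.2 p.2 :=
  primrec_evaln.comp (((Primrec.fst.comp Primrec.fst).pair
    ((Primrec.ofNat Code).comp (Primrec.snd.comp Primrec.fst))).pair Primrec.snd)

theorem primrec_outputBy_pair : Primrec₂ fun (s : ℕ) (p : ℕ × ℕ) => outputBy s p.1 p.2 :=
  primrec_outputBy.comp ((Primrec.fst.pair (Primrec.fst.comp Primrec.snd)).pair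
    (Primrec.snd.comp Primrec.snd))

theorem primrec_haltsAt : Primrec₂ haltsAt :=
  Primrec.and.comp
    (Primrec.option_isSome.comp
      (primrec_outputBy_pair.comp (Primrec.succ.comp Primrec.fst) Primrec.snd))
    ((Primrec.not.comp (Primrec.option_isSome.comp primrec_outputBy_pair)).of_eq fun p => by
      simp)

theorem primrec_cutAfter {α β : Type} [Primcodable α] [Primcodable β] {f : β → α → Bool}
    (hf : Primrec₂ f) : Primrec₂ fun b l => cutAfter (f b) l :=
  Primrec.list_foldr (f := fun p : β × List α => p.2) (g := fun _ => [])
    (h := fun p q => cond (f p.1 q.1) [q.1] (q.1 :: q.2)) Primrec.snd (Primrec.const [])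
    (Primrec.cond (hf.comp (Primrec.fst.comp Primrec.fst) (Primrec.fst.comp Primrec.snd))
      (Primrec.list_cons.comp (Primrec.fst.comp Primrec.snd) (Primrec.const []))
      (Primrec.list_cons.comp (Primrec.fst.comp Primrec.snd) (Primrec.snd.comp Primrec.snd))).to₂

theorem primrec_pushWitness : Primrec₂ pushWitness :=
  Primrec.cond (Primrec.nat_bodd.comp Primrec.fst) Primrec.snd
    (Primrec.list_concat.comp Primrec.snd
      ((Primrec.list_length.comp Primrec.snd).pair Primrec.fst))

theorem primrec_witnesses : Primrec witnesses :=
  Primrec.nat_rec₁ _ ((primrec_cutAfter primrec_haltsAt).comp Primrec.fst primrec_pushWitness)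

theorem primrecRel_rejected : PrimrecRel Rejected := by
  have h : PrimrecRel fun (p : ℕ × ℕ) (q : ℕ × ℕ) => p.2 = q.1 ∧ outputBy q.2 p.1 p.2 = some 0 :=
    PrimrecPred.and
      (Primrec.eq.comp (Primrec.snd.comp Primrec.fst) (Primrec.fst.comp Primrec.snd))
      (Primrec.eq.comp (primrec_outputBy_pair.comp (Primrec.snd.comp Primrec.snd) Primrec.fst)
        (Primrec.const _))
  exact h.exists_mem_list.comp (primrec_witnesses.comp Primrec.snd) Primrec.id

theorem primrecRel_accepted : PrimrecRel Accepted := by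
  have h : PrimrecRel fun (p : ℕ × ℕ) (q : ℕ × ℕ) => p.2 = q.1 ∧
      (outputBy q.2 p.1 p.2).isSome ∧ outputBy q.2 p.1 p.2 ≠ some 0 := by
    have ho : Primrec fun r : (ℕ × ℕ) × (ℕ × ℕ) => outputBy r.2.2 r.1.1 r.1.2 :=
      primrec_outputBy_pair.comp (Primrec.snd.comp Primrec.snd) Primrec.fst
    exact PrimrecPred.and
      (Primrec.eq.comp (Primrec.snd.comp Primrec.fst) (Primrec.fst.comp Primrec.snd))
      (PrimrecPred.and (Primrec.eq.comp (Primrec.option_isSome.comp ho) (Primrec.const true))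
        (PrimrecPred.not (Primrec.eq.comp ho (Primrec.const _))))
  exact h.exists_mem_list.comp (primrec_witnesses.comp Primrec.snd) Primrec.id

theorem primrecRel_witnessLE : PrimrecRel witnessLE :=
  PrimrecPred.or (Primrec.eq (α := ℕ)) (PrimrecPred.or primrecRel_rejected
    (primrecRel_accepted.comp Primrec.snd Primrec.fst))

/-! #### Dynamics of the stack of witnesses -/

section CutAfter

variable {α : Type} {f : α → Bool}

theorem cutAfter_cons (a : α) (l : List α) :
    cutAfter f (a :: l) = cond (f a) [a] (a :: cutAfter f l) := rfl

theorem cutAfter_prefix (l : List α) : cutAfter f l <+: l := by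
  induction l with
  | nil => exact List.nil_prefix
  | cons a l ih =>
    rw [cutAfter_cons]
    cases f a
    · exact (List.prefix_cons_inj a).2 ih
    · exact (List.prefix_cons_inj a).2 List.nil_prefix

theorem cutAfter_prefix_of_mem {l₁ l₂ : List α} {a : α} (ha : a ∈ l₁) (hf : f a) :
    cutAfter f (l₁ ++ l₂) <+: l₁ := by
  induction l₁ with
  | nil => simp at ha
  | cons b l ih =>
    rw [List.cons_append, cutAfter_cons]
    cases hb : f b
    · have hal : a ∈ l := by
        rcases List.mem_cons.1 ha with rfl | h
        · simp [hb] at hf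
        · exact h
      exact (List.prefix_cons_inj b).2 (ih hal)
    · exact (List.prefix_cons_inj b).2 List.nil_prefix

/-- The cut falls behind the element that triggers it, so `a` survives even when `f a` holds. -/
theorem prefix_cutAfter {l₁ l₂ : List α} {a : α} (h : ∀ b ∈ l₁, f b = false) :
    l₁ ++ [a] <+: cutAfter f (l₁ ++ a :: l₂) := by
  induction l₁ with
  | nil =>
    rw [List.nil_append, List.nil_append, cutAfter_cons]
    cases f a
    · exact (List.prefix_cons_inj a).2 List.nil_prefix
    · exact List.prefix_rfl
  | cons b l ih =>
    rw [List.cons_append, List.cons_append, cutAfter_cons, h b List.mem_cons_self]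
    exact (List.prefix_cons_inj b).2 (ih fun c hc => h c (List.mem_cons_of_mem _ hc))

end CutAfter

theorem outputBy_mono {s t e x v : ℕ} (hst : s ≤ t) (h : outputBy s e x = some v) :
    outputBy t e x = some v :=
  evaln_mono hst h

theorem outputBy_succ {s : ℕ} {p : ℕ × ℕ} (h : haltsAt s p = false) :
    outputBy (s + 1) p.1 p.2 = outputBy s p.1 p.2 := by
  cases hs : outputBy s p.1 p.2 with
  | some v => exact outputBy_mono s.le_succ hs
  | none => simpa [haltsAt, hs] using h

theorem witnesses_succ (s : ℕ) :
    witnesses (s + 1) = cutAfter (haltsAt s) (pushWitness s (witnesses s)) := rfl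

theorem prefix_pushWitness (s : ℕ) (l : List (ℕ × ℕ)) : l <+: pushWitness s l := by
  rw [pushWitness]
  cases s.bodd
  · exact List.prefix_append _ _
  · exact List.prefix_rfl

theorem mem_pushWitness {s : ℕ} {l : List (ℕ × ℕ)} {p : ℕ × ℕ} (h : p ∈ pushWitness s l) :
    p ∈ l ∨ p.2 = s ∧ s.bodd = false ∧ pushWitness s l = l ++ [p] := by
  rw [pushWitness] at h ⊢
  cases hs : s.bodd
  · rw [hs] at h
    rcases List.mem_append.1 h with h | h
    · exact Or.inl h
    · rw [List.mem_singleton] at h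
      subst h
      exact Or.inr ⟨rfl, rfl, rfl⟩
  · rw [hs] at h
    exact Or.inl h

/-- A new entry is labelled with the length of the stack and cuts leave prefixes, so labels and
positions always agree. -/
theorem witnesses_index (s : ℕ) : ∀ (i : ℕ) (p : ℕ × ℕ), (witnesses s)[i]? = some p → p.1 = i := by
  induction s with
  | zero =>
    intro i p h
    simp [witnesses] at h
  | succ s ih =>
    intro i p h
    have h' : (pushWitness s (witnesses s))[i]? = some p := by
      obtain ⟨r, hr⟩ := cutAfter_prefix (f := haltsAt s) (pushWitness s (witnesses s))
      rw [← hr, ← witnesses_succ, List.getElem?_append_left (List.getElem?_eq_some_iff.1 h).1, h]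
    rw [pushWitness] at h'
    cases hs : s.bodd
    · rw [hs, cond_false, List.getElem?_append] at h'
      split_ifs at h' with hi
      · exact ih i p h'
      · rw [List.getElem?_singleton] at h'
        split_ifs at h' with h₀
        rw [← Option.some.inj h']
        change (witnesses s).length = i
        omega
    · rw [hs] at h'
      exact ih i p h'

theorem index_of_prefix {l : List (ℕ × ℕ)} {p : ℕ × ℕ} {s : ℕ} (h : l ++ [p] <+: witnesses s) :
    p.1 = l.length := by
  obtain ⟨r, hr⟩ := h
  refine witnesses_index s _ p ?_
  rw [← hr, List.append_assoc, List.getElem?_append_right le_rfl]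
  simp

/-- When a witness was appointed, the stack was a prefix of the present one, and the status of its
entries has not changed since. -/
theorem mem_witnesses (s : ℕ) : ∀ p ∈ witnesses s, p.2 < s ∧ p.2.bodd = false ∧
    witnesses p.2 ++ [p] <+: witnesses s ∧
    ∀ q ∈ witnesses p.2, outputBy s q.1 q.2 = outputBy p.2 q.1 q.2 := by
  induction s using Nat.strong_induction_on with
  | _ s ih =>
  cases s with
  | zero =>
    intro p hp
    simp [witnesses] at hp
  | succ s =>
    have key : ∀ p ∈ witnesses (s + 1), p.2 < s + 1 →
        witnesses p.2 ++ [p] <+: pushWitness s (witnesses s) →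
        (∀ q ∈ witnesses p.2, outputBy s q.1 q.2 = outputBy p.2 q.1 q.2) →
        witnesses p.2 ++ [p] <+: witnesses (s + 1) ∧
        ∀ q ∈ witnesses p.2, outputBy (s + 1) q.1 q.2 = outputBy p.2 q.1 q.2 := by
      intro p hp hlt hpre hout
      obtain ⟨r, hr⟩ := hpre
      rw [List.append_assoc, List.singleton_append] at hr
      -- Had such a `q` halted now, the cut would leave a prefix of `witnesses p.2`. Then `p` would
      -- lie in `witnesses p.2`, and the induction hypothesis at stage `p.2` would give `p.2 < p.2`.
      have hfresh : ∀ q ∈ witnesses p.2, haltsAt s q = false := by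
        intro q hq
        by_contra hh
        rw [Bool.not_eq_false] at hh
        rw [witnesses_succ, ← hr] at hp
        exact lt_irrefl _ (ih p.2 hlt p ((cutAfter_prefix_of_mem hq hh).subset hp)).1
      refine ⟨?_, fun q hq => (outputBy_succ (hfresh q hq)).trans (hout q hq)⟩
      rw [witnesses_succ, ← hr]
      exact prefix_cutAfter hfresh
    intro p hp
    rcases mem_pushWitness ((cutAfter_prefix _).subset hp) with h | ⟨rfl, hodd, he⟩
    · obtain ⟨h₁, h₂, h₃, h₄⟩ := ih s s.lt_succ_self p h
      exact ⟨by omega, h₂, key p hp (by omega) (h₃.trans (prefix_pushWitness _ _)) h₄⟩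
    · exact ⟨Nat.lt_succ_self _, hodd, key p hp (Nat.lt_succ_self _) (he ▸ List.prefix_rfl)
        fun q _ => rfl⟩

/-- Every position of the stack is eventually occupied by a permanent witness. -/
theorem exists_permanent_prefix (e : ℕ) : ∃ (s₀ : ℕ) (l : List (ℕ × ℕ)), l.length = e ∧
    ∀ s ≥ s₀, l <+: witnesses s ∧ ∀ p ∈ l, haltsAt s p = false := by
  induction e with
  | zero => exact ⟨0, [], rfl, fun s _ => ⟨List.nil_prefix, by simp⟩⟩
  | succ e ih =>
    obtain ⟨s₀, l, hl, h⟩ := ih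
    obtain ⟨t, ht, p, hp⟩ : ∃ t ≥ s₀, ∃ p, l ++ [p] <+: pushWitness t (witnesses t) := by
      -- New witnesses are appointed at even stages only.
      obtain ⟨t, ht, hodd⟩ : ∃ t ≥ s₀, t.bodd = false := by
        cases hs : s₀.bodd
        · exact ⟨s₀, le_rfl, hs⟩
        · exact ⟨s₀ + 1, Nat.le_succ _, by simp [hs]⟩
      obtain ⟨r, hr⟩ := (h t ht).1
      refine ⟨t, ht, ?_⟩
      rw [pushWitness, hodd, cond_false]
      rcases r with _ | ⟨q, r⟩
      · rw [List.append_nil] at hr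
        exact ⟨((witnesses t).length, t), by rw [hr]⟩
      · exact ⟨q, r ++ [((witnesses t).length, t)], by simp [← hr]⟩
    have hstep : ∀ s ≥ s₀, l ++ [p] <+: pushWitness s (witnesses s) →
        l ++ [p] <+: witnesses (s + 1) := by
      rintro s hs ⟨r, hr⟩
      rw [List.append_assoc, List.singleton_append] at hr
      rw [witnesses_succ, ← hr]
      exact prefix_cutAfter (h s hs).2
    have hperm : ∀ s ≥ t + 1, l ++ [p] <+: witnesses s := by
      intro s hs
      induction s, hs using Nat.le_induction with
      | base => exact hstep t ht hp
      | succ s hs ih => exact hstep s (by omega) (ih.trans (prefix_pushWitness _ _))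
    -- `haltsAt` marks only the first stage at which the output is seen, so `p` discards the entries
    -- after it at most once.
    obtain ⟨u, hu⟩ : ∃ u, ∀ s ≥ u, haltsAt s p = false := by
      by_cases hc : ∃ u v, outputBy u p.1 p.2 = some v
      · obtain ⟨u, v, huv⟩ := hc
        refine ⟨u, fun s hs => ?_⟩
        simp [haltsAt, outputBy_mono hs huv]
      · refine ⟨0, fun s _ => ?_⟩
        have : outputBy (s + 1) p.1 p.2 = none := by
          rw [Option.eq_none_iff_forall_ne_some]
          exact fun v hv => hc ⟨_, v, hv⟩
        simp [haltsAt, this]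
    refine ⟨max (t + 1) u, l ++ [p], by simp [hl], fun s hs => ⟨hperm s (by omega), ?_⟩⟩
    intro q hq
    rcases List.mem_append.1 hq with hq | hq
    · exact (h s (by omega)).2 q hq
    · rw [List.mem_singleton.1 hq]
      exact hu s (by omega)

theorem exists_permanent_witness (e : ℕ) : ∃ x s₀, ∀ s ≥ s₀, (e, x) ∈ witnesses s := by
  obtain ⟨s₀, l, hl, h⟩ := exists_permanent_prefix (e + 1)
  obtain ⟨l, p, rfl⟩ := List.eq_nil_or_concat' l |>.resolve_left (by rintro rfl; simp at hl)
  have hp : p.1 = e := by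
    rw [index_of_prefix (h s₀ le_rfl).1]
    simpa using hl
  refine ⟨p.2, s₀, fun s hs => (h s hs).1.subset ?_⟩
  simp [← hp]

/-! #### The order -/

/-- `x` is a witness at stage `z`, and its program is seen to output `v` on it. -/
def Settled (v x z : ℕ) : Prop := ∃ e, (e, x) ∈ witnesses z ∧ outputBy z e x = some v

theorem rejected_iff {x z : ℕ} : Rejected x z ↔ Settled 0 x z := by
  constructor
  · rintro ⟨⟨e, x⟩, h, rfl, ho⟩
    exact ⟨e, h, ho⟩
  · rintro ⟨e, h, ho⟩
    exact ⟨⟨e, x⟩, h, rfl, ho⟩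

theorem accepted_iff {x z : ℕ} : Accepted x z ↔ ∃ v ≠ 0, Settled v x z := by
  constructor
  · rintro ⟨⟨e, x⟩, h, rfl, hs, ho⟩
    obtain ⟨v, hv⟩ := Option.isSome_iff_exists.1 hs
    exact ⟨v, fun h₀ => ho (by rw [hv, h₀]), e, h, hv⟩
  · rintro ⟨v, hv, e, h, ho⟩
    exact ⟨⟨e, x⟩, h, rfl, by simp [ho], by simp [ho, hv]⟩

theorem witnessLE_iff {x z : ℕ} :
    witnessLE x z ↔ x = z ∨ Settled 0 x z ∨ ∃ v ≠ 0, Settled v z x := by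
  rw [witnessLE, rejected_iff, accepted_iff]

namespace Settled

variable {a b c v w : ℕ}

theorem lt (h : Settled v a b) : a < b := by
  obtain ⟨e, h, -⟩ := h
  exact (mem_witnesses b _ h).1

theorem even (h : Settled v a b) : a.bodd = false := by
  obtain ⟨e, h, -⟩ := h
  exact (mem_witnesses b _ h).2.1

/-- The index of a witness `a` is the length of `witnesses a`, whatever the stage of inspection. So
`a` serves a single program and is never both rejected and accepted. -/
theorem unique (h : Settled v a b) (h' : Settled w a c) : v = w := by
  obtain ⟨e, h, ho⟩ := h
  obtain ⟨e', h', ho'⟩ := h'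
  have : e = e' := (index_of_prefix (mem_witnesses b _ h).2.2.1).trans
    (index_of_prefix (mem_witnesses c _ h').2.2.1).symm
  subst this
  exact Option.some.inj ((outputBy_mono (le_max_left b c) ho).symm.trans
    (outputBy_mono (le_max_right b c) ho'))

theorem trans (h : Settled v a b) (h' : Settled w b c) : Settled v a c := by
  have hbc := h'.lt
  obtain ⟨e, h, ho⟩ := h
  obtain ⟨e', h', -⟩ := h'
  exact ⟨e, (mem_witnesses c _ h').2.2.1.subset (List.mem_append_left _ h),
    outputBy_mono hbc.le ho⟩

/-- Both appointment stacks are prefixes of `witnesses b`, hence comparable; as `a < c`, the witness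
`a` was already present when `c` was appointed. Its output had been seen by then, since the outputs
of entries before `c` have not changed between stages `c` and `b`. -/
theorem of_lt (h : Settled v a b) (h' : Settled w c b) (hac : a < c) : Settled v a c := by
  obtain ⟨e, h, ho⟩ := h
  obtain ⟨e', h', -⟩ := h'
  obtain ⟨-, -, h₁, -⟩ := mem_witnesses b _ h
  obtain ⟨-, -, h₂, ho₂⟩ := mem_witnesses b _ h'
  have hmem : (e, a) ∈ witnesses c := by
    rcases List.prefix_or_prefix_of_prefix h₁ h₂ with h₃ | h₃
    · have := h₃.subset (List.mem_append_right _ (List.mem_singleton_self (e, a)))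
      rcases List.mem_append.1 this with h₄ | h₄
      · exact h₄
      · simp only [List.mem_singleton, Prod.mk.injEq] at h₄
        omega
    · have := h₃.subset (List.mem_append_right _ (List.mem_singleton_self (e', c)))
      rcases List.mem_append.1 this with h₄ | h₄
      · have := (mem_witnesses a _ h₄).1
        change c < a at this
        omega
      · simp only [List.mem_singleton, Prod.mk.injEq] at h₄
        omega
  exact ⟨e, hmem, (ho₂ _ hmem).symm.trans ho⟩

end Settled

theorem isPartialOrderOn_witnessLE : IsPartialOrderOn Set.univ witnessLE where
  field _ _ _ := ⟨trivial, trivial⟩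
  refl _ _ := Or.inl rfl
  antisymm x y h h' := by
    rw [witnessLE_iff] at h h'
    rcases h with h | h | ⟨v, hv, h⟩
    · exact h
    · rcases h' with h' | h' | ⟨w, hw, h'⟩
      · exact h'.symm
      · exact absurd h.lt h'.lt.not_gt
      · exact absurd (h'.unique h) hw
    · rcases h' with h' | h' | ⟨w, hw, h'⟩
      · exact h'.symm
      · exact absurd (h.unique h') hv
      · exact absurd h.lt h'.lt.not_gt
  trans a b c h h' := by
    rw [witnessLE_iff] at *
    rcases h with rfl | h | ⟨v, hv, h⟩
    · exact h'
    · rcases h' with rfl | h' | ⟨w, hw, h'⟩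
      · exact Or.inr (Or.inl h)
      · exact Or.inr (Or.inl (h.trans h'))
      -- Here `a` is rejected and `c` accepted at stage `b`. Whichever of the two was appointed
      -- first was already settled when the other one came, which places `a` below `c`.
      · rcases lt_trichotomy a c with hac | hac | hac
        · exact Or.inr (Or.inl (h.of_lt h' hac))
        · exact Or.inl hac
        · exact Or.inr (Or.inr ⟨w, hw, h'.of_lt h hac⟩)
    · rcases h' with rfl | h' | ⟨w, hw, h'⟩
      · exact Or.inr (Or.inr ⟨v, hv, h⟩)
      · exact absurd (h.unique h') hv
      · exact Or.inr (Or.inr ⟨w, hw, h'.trans h⟩)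

theorem isAntichain_odd : IsAntichain witnessLE {n | n.bodd = true} := by
  intro x hx y hy hxy h
  rw [Set.mem_ofPred_eq] at hx hy
  rcases witnessLE_iff.1 h with h | h | ⟨v, -, h⟩
  · exact hxy h
  · simp [h.even] at hx
  · simp [h.even] at hy

/-! ### Computable initial intervals are finitely generated -/

/-- From some point on, all numbers lie on the same side of a witness for deciding `J`. -/
theorem exists_bound_of_computablePred {J : Set ℕ} (hJ : ComputablePred fun x => x ∈ J) :
    ∃ x s₀, (x ∈ J ∧ ∀ z ≥ s₀, witnessLE z x) ∨ (x ∉ J ∧ ∀ z ≥ s₀, witnessLE x z) := by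
  classical
  -- The characteristic function takes the value `0` outside `J`, matching rejection, and `1` on
  -- `J`, matching acceptance.
  have hf : Computable fun x => if x ∈ J then 1 else 0 :=
    ComputablePred.ite (Computable.const 1) (Computable.const 0) hJ
  obtain ⟨c, hc⟩ := Nat.Partrec.Code.exists_code.1 (Partrec.nat_iff.1 hf.partrec)
  obtain ⟨x, s₀, hx⟩ := exists_permanent_witness (Encodable.encode c)
  have hev : (if x ∈ J then 1 else 0) ∈ eval c x := by
    rw [hc]
    exact Part.mem_some _
  obtain ⟨k, hk⟩ := evaln_complete.1 hev
  -- From `s₀` on the witness is permanent, and by stage `k` its output has been seen.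
  have hset : ∀ z ≥ max s₀ k, Settled (if x ∈ J then 1 else 0) x z := by
    intro z hz
    refine ⟨_, hx z (by omega), outputBy_mono (show k ≤ z by omega) ?_⟩
    rw [outputBy, Denumerable.ofNat_encode]
    exact hk
  refine ⟨x, max s₀ k, ?_⟩
  by_cases hxJ : x ∈ J
  · refine Or.inl ⟨hxJ, fun z hz => witnessLE_iff.2 (Or.inr (Or.inr ⟨1, one_ne_zero, ?_⟩))⟩
    simpa only [if_pos hxJ] using hset z hz
  · refine Or.inr ⟨hxJ, fun z hz => witnessLE_iff.2 (Or.inr (Or.inl ?_))⟩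
    simpa only [if_neg hxJ] using hset z hz

theorem eq_downClosure_of_computable {J : Set ℕ} (hJ : ComputablePred fun x => x ∈ J)
    (hI : IsInitialInterval Set.univ witnessLE J) :
    ∃ F : Finset ℕ, J = downClosure Set.univ witnessLE F := by
  classical
  obtain ⟨x, s₀, h⟩ := exists_bound_of_computablePred hJ
  have hdown : ∀ y z, witnessLE y z → z ∈ J → y ∈ J := fun y z => hI.2 y trivial z trivial
  -- The range is long enough to contain `x` and every number below `s₀`.
  refine ⟨(Finset.range (s₀ + x + 1)).filter (· ∈ J), Set.ext fun y => ⟨fun hy => ?_, ?_⟩⟩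
  · refine ⟨trivial, ?_⟩
    by_cases hys : y < s₀
    · exact ⟨y, Finset.mem_coe.2 (Finset.mem_filter.2
        ⟨Finset.mem_range.2 (by omega), hy⟩), Or.inl rfl⟩
    · rcases h with ⟨hx, h⟩ | ⟨hx, h⟩
      · exact ⟨x, Finset.mem_coe.2 (Finset.mem_filter.2
          ⟨Finset.mem_range.2 (by omega), hx⟩), h y (by omega)⟩
      · exact absurd (hdown _ _ (h y (by omega)) hy) hx
  · rintro ⟨-, z, hz, hyz⟩
    simp only [Finset.coe_filter, Set.mem_ofPred_eq] at hz
    exact hdown _ _ hyz hz.2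

/-- The `n`-th finitely generated initial interval. -/
def finitelyGenerated (n : ℕ) : Set ℕ :=
  downClosure Set.univ witnessLE {x | x ∈ Denumerable.ofNat (List ℕ) n}

theorem computablePred_finitelyGenerated :
    ComputablePred fun p : ℕ × ℕ => p.1 ∈ finitelyGenerated p.2 := by
  have h : PrimrecRel fun y x => witnessLE x y := primrecRel_witnessLE.comp Primrec.snd Primrec.fst
  refine PrimrecPred.computablePred (PrimrecPred.of_eq
    (h.exists_mem_list.comp ((Primrec.ofNat (List ℕ)).comp Primrec.snd) Primrec.fst) fun p => ?_)
  simp [finitelyGenerated, downClosure]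

theorem isInitialInterval_finitelyGenerated (n : ℕ) :
    IsInitialInterval Set.univ witnessLE (finitelyGenerated n) := by
  refine ⟨Set.subset_univ _, ?_⟩
  rintro x - y - hxy ⟨-, z, hz, hyz⟩
  exact ⟨trivial, z, hz, isPartialOrderOn_witnessLE.trans _ _ _ hxy hyz⟩

theorem computable_isInitialInterval_iff (J : Set ℕ) :
    (ComputablePred (fun x => x ∈ J) ∧ IsInitialInterval Set.univ witnessLE J) ↔
      ∃ n, J = finitelyGenerated n := by
  constructor
  · rintro ⟨hJ, hI⟩
    obtain ⟨F, hF⟩ := eq_downClosure_of_computable hJ hI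
    refine ⟨Encodable.encode F.toList, ?_⟩
    rw [hF, finitelyGenerated, Denumerable.ofNat_encode]
    congr 1
    ext x
    simp
  · rintro ⟨n, rfl⟩
    exact ⟨computablePred_comp (f := fun x => (x, n)) computablePred_finitelyGenerated
      (Computable.id.pair (Computable.const n)), isInitialInterval_finitelyGenerated n⟩

end SOA

namespace SOA

open Structure

/-! ### The order inside `REC` -/

/-- Since `x ≤ 2 * (x + y)`, the integer square root of the code is `x + y`; the remainder is `x`.
-/
theorem pairCode_injective {x y x' y' : ℕ}
    (h : (x + y) * (x + y) + x = (x' + y') * (x' + y') + x') : x = x' ∧ y = y' := by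
  have hs := congrArg Nat.sqrt h
  rw [Nat.sqrt_add_eq _ (by omega), Nat.sqrt_add_eq _ (by omega)] at hs
  rw [hs] at h
  omega

theorem pairCode_mem_codeRel {le : ℕ → ℕ → Prop} {x y : ℕ} :
    (x + y) * (x + y) + x ∈ codeRel le ↔ le x y := by
  refine ⟨?_, fun h => ⟨x, y, h, rfl⟩⟩
  rintro ⟨x', y', h, he⟩
  obtain ⟨rfl, rfl⟩ := pairCode_injective he
  exact h

theorem codeRel_mem_computableSets {le : ℕ → ℕ → Prop}
    (h : ComputablePred fun p : ℕ × ℕ => le p.1 p.2) : codeRel le ∈ computableSets := by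
  have hfst : Primrec fun z : ℕ => z - z.sqrt * z.sqrt :=
    Primrec.nat_sub.comp Primrec.id (Primrec.nat_mul.comp Primrec.nat_sqrt Primrec.nat_sqrt)
  have hsnd : Primrec fun z : ℕ => z.sqrt - (z - z.sqrt * z.sqrt) :=
    Primrec.nat_sub.comp Primrec.nat_sqrt hfst
  -- Not every number is a code: this test singles out the codes, and without it truncated
  -- subtraction would decode other numbers as well.
  have hle : ComputablePred fun z : ℕ => z - z.sqrt * z.sqrt ≤ z.sqrt :=
    (Primrec.nat_le.comp hfst Primrec.nat_sqrt).computablePred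
  have hr := computablePred_comp h (hfst.pair hsnd).to_comp
  refine (computablePred_imp hle hr.not).not.of_eq fun z => ?_
  rw [Classical.not_imp, not_not]
  have hz := Nat.sqrt_le z
  constructor
  · rintro ⟨h₁, h₂⟩
    refine ⟨_, _, h₂, ?_⟩
    rw [Nat.add_sub_cancel' h₁, Nat.add_sub_cancel' hz]
  · rintro ⟨x, y, hxy, rfl⟩
    have hs : ((x + y) * (x + y) + x).sqrt = x + y := Nat.sqrt_add_eq _ (by omega)
    simp only [hs, Nat.add_sub_cancel_left]
    exact ⟨Nat.le_add_right x y, hxy⟩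

/-! ### Satisfaction of the formalized order notions in `REC` -/

section Sat

variable {P : Set ℕ} {le : ℕ → ℕ → Prop} (hP : P ∈ REC.sets) (hR : codeRel le ∈ REC.sets)
  (v : ℕ → REC.Num) (V : ℕ → REC.sets)

theorem sat_partialOrderF (h : IsPartialOrderOn P le) :
    REC.Sat v (cons ⟨codeRel le, hR⟩ (cons ⟨P, hP⟩ V)) (partialOrderF 1 0) := by
  simp only [partialOrderF, sat_and, sat_allN, sat_imp, sat_exN]
  refine ⟨?_, ?_, ?_, ?_⟩
  · rintro z ⟨x, y, hxy, hz⟩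
    exact ⟨x, y, (h.field x y hxy).1, (h.field x y hxy).2, hz⟩
  · exact fun x hx => pairCode_mem_codeRel.2 (h.refl x hx)
  · exact fun x y hxy hyx =>
      h.antisymm x y (pairCode_mem_codeRel.1 hxy) (pairCode_mem_codeRel.1 hyx)
  · exact fun x y z hxy hyz => pairCode_mem_codeRel.2
      (h.trans x y z (pairCode_mem_codeRel.1 hxy) (pairCode_mem_codeRel.1 hyz))

/-- Only computable `J` matter, because the set quantifiers of `REC` range over computable sets;
uniform computability of `I` makes the coded sequence itself a set of `REC`. -/
theorem sat_countablyManyInitialIntervalsF {I : ℕ → Set ℕ}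
    (hI : ComputablePred fun p : ℕ × ℕ => p.1 ∈ I p.2)
    (h : ∀ J : Set ℕ, ComputablePred (fun x => x ∈ J) → IsInitialInterval P le J →
      ∃ n, J = I n) :
    REC.Sat v (cons ⟨codeRel le, hR⟩ (cons ⟨P, hP⟩ V)) (countablyManyInitialIntervalsF 1 0) := by
  simp only [countablyManyInitialIntervalsF, initialIntervalF, subsetF, sat_exS, sat_allS,
    sat_and, sat_allN, sat_imp, sat_exN, sat_iff]
  refine ⟨⟨codeRel fun x n => x ∈ I n, codeRel_mem_computableSets hI⟩, ?_⟩
  rintro ⟨J, hJ⟩ ⟨hsub, hdown⟩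
  obtain ⟨n, rfl⟩ := h J hJ ⟨hsub, fun x hx y hy hxy hyJ =>
    hdown x y hx hy ⟨pairCode_mem_codeRel.2 hxy, hyJ⟩⟩
  exact ⟨n, fun x => (pairCode_mem_codeRel (le := fun x n => x ∈ I n)).symm⟩

theorem sat_infiniteAntichainF {D : Set ℕ} (hDP : D ⊆ P) (hD : ComputablePred fun x => x ∈ D)
    (hinf : D.Infinite) (hanti : IsAntichain le D) :
    REC.Sat v (cons ⟨codeRel le, hR⟩ (cons ⟨P, hP⟩ V)) (infiniteAntichainF 1 0) := by
  simp only [infiniteAntichainF, antichainF, subsetF, infiniteF, sat_exS, sat_and, sat_allN,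
    sat_imp, sat_exN, sat_neg]
  refine ⟨⟨D, hD⟩, ⟨hDP, fun x y hx hy hxy => ⟨fun h => ?_, fun h => ?_⟩⟩, fun n => ?_⟩
  · exact hanti hx hy hxy (pairCode_mem_codeRel.1 h)
  · exact hanti hy hx (Ne.symm hxy) (pairCode_mem_codeRel.1 h)
  · obtain ⟨m, hm, hnm⟩ := hinf.exists_gt n
    exact ⟨m, hnm, hm⟩

end Sat

theorem REC_models_neg_of_sat {P R : REC.sets}
    (h : ∀ v V, REC.Sat v (cons R (cons P V)) (partialOrderF 1 0 ⩓ₐ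
      countablyManyInitialIntervalsF 1 0 ⩓ₐ infiniteAntichainF 1 0)) :
    REC.Models (Formula.neg countablyManyIntervalsNoInfiniteAntichain) := by
  intro v V hs
  obtain ⟨h₁, h₂, h₃⟩ : _ ∧ _ ∧ _ := by
    have := h v V
    rwa [sat_and, sat_and] at this
  -- The outer quantifier binds the carrier (index `1`), the inner one the relation (index `0`).
  have := hs P R
  rw [sat_imp, sat_and, sat_neg] at this
  exact this ⟨h₁, h₂⟩ h₃

theorem setOf_odd_infinite : {n : ℕ | n.bodd = true}.Infinite :=
  Set.infinite_of_forall_exists_gt fun n => by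
    cases h : n.bodd
    · exact ⟨n + 1, by simp [h], n.lt_succ_self⟩
    · exact ⟨n + 2, by simp [h], by omega⟩

theorem computablePred_odd : ComputablePred fun n => n ∈ {n : ℕ | n.bodd = true} :=
  (Primrec.eq.comp Primrec.nat_bodd (Primrec.const true)).computablePred

theorem univ_mem_computableSets : (Set.univ : Set ℕ) ∈ computableSets :=
  ⟨fun _ => .isTrue trivial, Computable.const true⟩

theorem codeRel_witnessLE_mem_computableSets : codeRel witnessLE ∈ computableSets :=
  codeRel_mem_computableSets primrecRel_witnessLE.computablePred

theorem sat_witnessLE (v : ℕ → REC.Num) (V : ℕ → REC.sets) :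
    REC.Sat v (cons ⟨codeRel witnessLE, codeRel_witnessLE_mem_computableSets⟩
      (cons ⟨Set.univ, univ_mem_computableSets⟩ V))
      (partialOrderF 1 0 ⩓ₐ countablyManyInitialIntervalsF 1 0 ⩓ₐ infiniteAntichainF 1 0) := by
  rw [sat_and, sat_and]
  exact ⟨sat_partialOrderF _ _ v V isPartialOrderOn_witnessLE,
    sat_countablyManyInitialIntervalsF _ _ v V computablePred_finitelyGenerated
      fun J hJ hI => (computable_isInitialInterval_iff J).1 ⟨hJ, hI⟩,
    sat_infiniteAntichainF _ _ v V (Set.subset_univ _) computablePred_odd setOf_odd_infinite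
      isAntichain_odd⟩

end SOA

theorem theorem5p13 :
    -- `RCA₀` does not prove the statement
    ¬ SOA.Provable SOA.RCA0 SOA.countablyManyIntervalsNoInfiniteAntichain ∧
    -- `REC` is a model of `RCA₀` in which the statement fails
    (∀ φ ∈ SOA.RCA0, SOA.REC.Models φ) ∧
    SOA.REC.Models (SOA.Formula.neg SOA.countablyManyIntervalsNoInfiniteAntichain) ∧
    -- the failure is witnessed by a computable partial order `(P, le)`
    ∃ (P : Set ℕ) (le : ℕ → ℕ → Prop),
      SOA.IsPartialOrderOn P le ∧
      ComputablePred (fun x => x ∈ P) ∧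
      ComputablePred (fun p : ℕ × ℕ => le p.1 p.2) ∧
      -- computable initial intervals are downward closures of finite subsets
      (∀ I : Set ℕ, ComputablePred (fun x => x ∈ I) → SOA.IsInitialInterval P le I →
        ∃ F : Finset ℕ, (F : Set ℕ) ⊆ P ∧ I = SOA.downClosure P le F) ∧
      -- the computable initial intervals are uniformly listed
      (∃ I : ℕ → Set ℕ, ComputablePred (fun p : ℕ × ℕ => p.1 ∈ I p.2) ∧
        ∀ J : Set ℕ, (ComputablePred (fun x => x ∈ J) ∧ SOA.IsInitialInterval P le J) ↔
          ∃ n, J = I n) ∧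
      -- there is a computable infinite antichain
      (∃ D : Set ℕ, D ⊆ P ∧ ComputablePred (fun x => x ∈ D) ∧ D.Infinite ∧ IsAntichain le D) ∧
      -- `REC` sees that `P` is a partial order with countably many initial intervals and
      -- with an infinite antichain
      ∃ (hP : P ∈ SOA.REC.sets) (hR : SOA.codeRel le ∈ SOA.REC.sets),
        ∀ (v : ℕ → SOA.REC.Num) (V : ℕ → SOA.REC.sets),
          SOA.REC.Sat v (SOA.cons ⟨SOA.codeRel le, hR⟩ (SOA.cons ⟨P, hP⟩ V))
            (SOA.Formula.and (SOA.partialOrderF 1 0)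
              (SOA.Formula.and (SOA.countablyManyInitialIntervalsF 1 0)
                (SOA.infiniteAntichainF 1 0))) := by
  have hneg := SOA.REC_models_neg_of_sat SOA.sat_witnessLE
  refine ⟨fun h => ?_, SOA.REC_models_RCA0, hneg, Set.univ, SOA.witnessLE,
    SOA.isPartialOrderOn_witnessLE, SOA.univ_mem_computableSets,
    SOA.primrecRel_witnessLE.computablePred, ?_,
    ⟨SOA.finitelyGenerated, SOA.computablePred_finitelyGenerated,
      SOA.computable_isInitialInterval_iff⟩,
    ⟨_, Set.subset_univ _, SOA.computablePred_odd, SOA.setOf_odd_infinite, SOA.isAntichain_odd⟩,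
    SOA.univ_mem_computableSets, SOA.codeRel_witnessLE_mem_computableSets, SOA.sat_witnessLE⟩
  · exact hneg (fun _ => (0 : ℕ)) (fun _ => ⟨Set.univ, SOA.univ_mem_computableSets⟩)
      (h.sound SOA.REC_models_RCA0 _ _)
  · intro I hI hI'
    obtain ⟨F, hF⟩ := SOA.eq_downClosure_of_computable hI hI'
    exact ⟨F, Set.subset_univ _, hF⟩
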